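/- Let $d\ge 1$, let $X\subseteq\mathbb{R}^d$ be measurable with positive Lebesgue measure, and write $\langle f\rangle=\int_X f(x)\,dx$. For $\gamma\ge 0$ let $\mathcal F_\gamma$ be the set of measurable $f\ge 0$ on $X$, not almost everywhere zero, with $\langle f^{1+\gamma}\rangle<\infty$. Let $\mathcal D_\gamma$ be the set of pairs $(g,f)\in\mathcal F_\gamma\times\mathcal F_\gamma$ such that, in the case $\gamma=0$, also $\langle g\log f\rangle$ and $\langle g\log g\rangle$ are finite (in particular $g=0$ almost everywhere on $\{f=0\}$). **FDPD.** Let $\varphi:[0,\infty)\to[-\infty,\infty]$ be such that $\psi(s)=\varphi(e^s)$ is continuous, strictly increasing and convex on $[-\infty,\infty)$ (and, if $\gamma=0$, $\varphi$ is differentiable on $(0,\infty)$). The functional density power divergence is $$D_{\varphi,\gamma}(g,f)=\begin{cases}\frac1\gamma\varphi(\langle g^{1+\gamma}\rangle)-\frac{1+\gamma}{\gamma}\varphi(\langle gf^\gamma\rangle)+\varphi(\langle f^{1+\gamma}\rangle),&\gamma>0,\\ \varphi'(\langle g\rangle)\langle g\log\frac gf\rangle-\varphi(\langle g\rangle)+\varphi(\langle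 f\rangle),&\gamma=0.\end{cases}$$ **Hölder divergence.** If $\gamma>0$, let $\eta:[0,\infty)\to\mathbb{R}$ satisfy $\eta(1)=-1$ and $\eta(z)\ge -z^{1+\gamma}$ for all $z\ge0$. The Hölder score is $S_{\eta,\gamma}(g,f)=\eta\big(\langle gf^\gamma\rangle/\langle f^{1+\gamma}\rangle\big)\langle f^{1+\gamma}\rangle$ for $\gamma>0$, and $-\langle g\log f\rangle+\langle f\rangle$ for $\gamma=0$. A score $S$, with values in $[-\infty,\infty]$, is equivalent to $S_{\eta,\gamma}$ if $S=\tau\circ S_{\eta,\gamma}$ for a function $\tau$ with values in $[-\infty,\infty]$ that is strictly increasing on the set of values of $S_{\eta,\gamma}$. A Hölder divergence with parameter $\gamma$ is a function $D(g,f)=S(g,f)-S(g,g)$ where $S$ is equivalent to some Hölder score $S_{\eta,\gamma}$. **JHHB family.** For $\zeta\ge0$ put $$D_{\zeta,\gamma}(g,f)=\begin{cases}\frac1{\gamma\zeta}\langle g^{1+\gamma}\rangle^\zeta-\frac{1+\gamma}{\gamma\zeta}\langle gf^\gamma\rangle^\zeta+\frac1\zeta\langle f^{1+\gamma}\rangle^\zeta,&\gamma>0,\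 \zeta>0,\\ \frac1\gamma\log\langle g^{1+\gamma}\rangle-\frac{1+\gamma}\gamma\log\langle gf^\gamma\rangle+\log\langle f^{1+\gamma}\rangle,&\gamma>0,\ \zeta=0,\\ \langle g\rangle^{\zeta-1}\langle g\log\frac gf\rangle-\frac1\zeta\langle g\rangle^\zeta+\frac1\zeta\langle f\rangle^\zeta,&\gamma=0,\ \zeta>0,\\ \frac1{\langle g\rangle}\langle g\log\frac gf\rangle-\log\langle g\rangle+\log\langle f\rangle,&\gamma=0,\ \zeta=0.\end{cases}$$ **Statement.** The intersection of the Hölder divergences and the FDPDs is exactly, up to positive constant factors, the JHHB divergence family with $\gamma>0$, $\zeta\ge 0$ together with its member $\gamma=0$, $\zeta=1$. In detail: 1. For every $\gamma>0$, a function on $\mathcal D_\gamma$ is both an FDPD and a Hölder divergence with parameter $\gamma$ if and only if it equals $a\,D_{\zeta,\gamma}$ for some $a>0$ and $\zeta\ge0$. 2. A function on $\mathcal D_0$ is both an FDPD and a Hölder divergence with parameter $0$ if and only if it equals $a\,D_{1,0}$ for some $a>0$. 3. If $\gamma_1\ne\gamma_2$ (both $\ge 0$), no function on $\mathcal D_{\gamma_1}\cap\mathcal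 D_{\gamma_2}$ is both an FDPD with parameter $\gamma_1$ and a Hölder divergence with parameter $\gamma_2$. -/

import Mathlib

open MeasureTheory Set

noncomputable section

/-- The class `F_γ`: measurable nonnegative functions `f`, not almost everywhere zero, with
`⟨f ^ (1 + γ)⟩ < ∞`. -/
structure MemF {Ω : Type*} [MeasurableSpace Ω] (μ : Measure Ω) (γ : ℝ) (f : Ω → ℝ) : Prop where
  measurable : Measurable f
  nonneg : ∀ x, 0 ≤ f x
  ne_zero : ¬ (f =ᵐ[μ] 0)
  integrable : Integrable (fun x => f x ^ (1 + γ)) μ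

/-- The pairs `(g, f)` on which the divergences with parameter `γ` are considered: both functions
lie in `F_γ` and, if `γ = 0`, the integrals `⟨g log f⟩` and `⟨g log g⟩` are finite. Because
`Real.log 0 = 0` in Mathlib, finiteness of `⟨g log f⟩` includes the explicit requirement that `g`
vanishes almost everywhere on the zero set of `f`. -/
def Dom {Ω : Type*} [MeasurableSpace Ω] (μ : Measure Ω) (γ : ℝ) : Set ((Ω → ℝ) × (Ω → ℝ)) :=
  {p | MemF μ γ p.1 ∧ MemF μ γ p.2 ∧
    (γ = 0 →
      Integrable (fun x => p.1 x * Real.log (p.2 x)) μ ∧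
      Integrable (fun x => p.1 x * Real.log (p.1 x)) μ ∧
      ∀ᵐ x ∂μ, p.2 x = 0 → p.1 x = 0)}

/-- Generators `φ : [0, ∞) → [-∞, ∞]` of functional density power divergences: `ψ z = φ (e ^ z)` is
continuous and strictly increasing on `[-∞, ∞)` (equivalently, `φ` is so on `[0, ∞)`) and convex.
Strict monotonicity makes `φ` finite on `(0, ∞)`, so `toReal` loses nothing there. For `γ = 0` the
divergence involves `φ'`, so `φ` has to be differentiable on `(0, ∞)`. -/
structure IsFDPDGenerator (γ : ℝ) (φ : ℝ → EReal) : Prop where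
  continuousOn : ContinuousOn φ (Ici 0)
  strictMonoOn : StrictMonoOn φ (Ici 0)
  convexOn : ConvexOn ℝ univ (fun s : ℝ => (φ (Real.exp s)).toReal)
  differentiableOn : γ = 0 → DifferentiableOn ℝ (fun z => (φ z).toReal) (Ioi 0)

/-- The functional density power divergence `D_{φ,γ}(g, f)`. It may take the value `+∞`
(when `⟨g f ^ γ⟩ = 0` and `φ 0 = -∞`). -/
def fdpd {Ω : Type*} [MeasurableSpace Ω] (μ : Measure Ω) (φ : ℝ → EReal) (γ : ℝ)
    (g f : Ω → ℝ) : EReal :=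
  if γ = 0 then
    ((deriv (fun z => (φ z).toReal) (∫ x, g x ∂μ) * ∫ x, g x * Real.log (g x / f x) ∂μ : ℝ) : EReal)
      - φ (∫ x, g x ∂μ) + φ (∫ x, f x ∂μ)
  else
    ((1 / γ : ℝ) : EReal) * φ (∫ x, g x ^ (1 + γ) ∂μ)
      - (((1 + γ) / γ : ℝ) : EReal) * φ (∫ x, g x * f x ^ γ ∂μ)
      + φ (∫ x, f x ^ (1 + γ) ∂μ)

/-- The condition on the function `η : [0, ∞) → ℝ` in the Hölder score (void for `γ = 0`, where the
score does not involve `η`). -/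
def IsHolderGenerator (γ : ℝ) (η : ℝ → ℝ) : Prop :=
  0 < γ → η 1 = -1 ∧ ∀ z, 0 ≤ z → -z ^ (1 + γ) ≤ η z

/-- The Hölder score `S_{η,γ}(g, f)`. -/
def holderScore {Ω : Type*} [MeasurableSpace Ω] (μ : Measure Ω) (η : ℝ → ℝ) (γ : ℝ)
    (g f : Ω → ℝ) : ℝ :=
  if γ = 0 then
    -(∫ x, g x * Real.log (f x) ∂μ) + ∫ x, f x ∂μ
  else
    η ((∫ x, g x * f x ^ γ ∂μ) / ∫ x, f x ^ (1 + γ) ∂μ) * ∫ x, f x ^ (1 + γ) ∂μ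

/-- On the pairs in `A`, the (possibly infinite) score `S'` is equivalent to the real score `S`:
`S' = τ ∘ S` for a function `τ` that is strictly increasing on the set of values of `S`. -/
def ScoreEquivalent {α : Type*} (A : Set (α × α)) (S' : α → α → EReal) (S : α → α → ℝ) : Prop :=
  ∃ τ : ℝ → EReal, StrictMonoOn τ ((fun p : α × α => S p.1 p.2) '' A) ∧
    ∀ g f, (g, f) ∈ A → S' g f = τ (S g f)

/-- `D` is the divergence induced by the score `S` on the pairs in `A`. -/
def IsInducedBy {α : Type*} (A : Set (α × α)) (D S : α → α → EReal) : Prop :=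
  ∀ g f, (g, f) ∈ A → D g f = S g f - S g g

/-- The `D` that agree on the pairs in `A` with a functional density power divergence with
parameter `γ`. -/
def fdpdFamily {Ω : Type*} [MeasurableSpace Ω] (μ : Measure Ω) (γ : ℝ)
    (A : Set ((Ω → ℝ) × (Ω → ℝ))) : Set ((Ω → ℝ) → (Ω → ℝ) → EReal) :=
  {D | ∃ φ : ℝ → EReal, IsFDPDGenerator γ φ ∧ ∀ g f, (g, f) ∈ A → D g f = fdpd μ φ γ g f}

/-- The `D` that on the pairs in `A` are Hölder divergences with parameter `γ`, that is, induced by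
a score that is equivalent to a Hölder score. -/
def holderFamily {Ω : Type*} [MeasurableSpace Ω] (μ : Measure Ω) (γ : ℝ)
    (A : Set ((Ω → ℝ) × (Ω → ℝ))) : Set ((Ω → ℝ) → (Ω → ℝ) → EReal) :=
  {D | ∃ η : ℝ → ℝ, IsHolderGenerator γ η ∧
    ∃ S : (Ω → ℝ) → (Ω → ℝ) → EReal,
      ScoreEquivalent A S (holderScore μ η γ) ∧ IsInducedBy A D S}

/-- The JHHB divergence `D_{ζ,γ}(g, f)`. For `γ > 0`, `ζ = 0` it takes the value `+∞` when
`⟨g f ^ γ⟩ = 0`, and the logarithm is the extended one, with value `-∞` at `0`. -/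
def jhhb {Ω : Type*} [MeasurableSpace Ω] (μ : Measure Ω) (ζ γ : ℝ) (g f : Ω → ℝ) : EReal :=
  if γ = 0 then
    if ζ = 0 then
      ((1 / (∫ x, g x ∂μ) * (∫ x, g x * Real.log (g x / f x) ∂μ)
        - Real.log (∫ x, g x ∂μ) + Real.log (∫ x, f x ∂μ) : ℝ) : EReal)
    else
      (((∫ x, g x ∂μ) ^ (ζ - 1) * (∫ x, g x * Real.log (g x / f x) ∂μ)
        - 1 / ζ * (∫ x, g x ∂μ) ^ ζ + 1 / ζ * (∫ x, f x ∂μ) ^ ζ : ℝ) : EReal)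
  else
    if ζ = 0 then
      ((1 / γ : ℝ) : EReal) * ENNReal.log (ENNReal.ofReal (∫ x, g x ^ (1 + γ) ∂μ))
        - (((1 + γ) / γ : ℝ) : EReal) * ENNReal.log (ENNReal.ofReal (∫ x, g x * f x ^ γ ∂μ))
        + ENNReal.log (ENNReal.ofReal (∫ x, f x ^ (1 + γ) ∂μ))
    else
      ((1 / (γ * ζ) * (∫ x, g x ^ (1 + γ) ∂μ) ^ ζ
        - (1 + γ) / (γ * ζ) * (∫ x, g x * f x ^ γ ∂μ) ^ ζ
        + 1 / ζ * (∫ x, f x ^ (1 + γ) ∂μ) ^ ζ : ℝ) : EReal)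

/-- The `D` that agree on the pairs in `A` with a positive multiple of the JHHB divergence with
parameters `ζ`, `γ`. -/
def jhhbFamily {Ω : Type*} [MeasurableSpace Ω] (μ : Measure Ω) (ζ γ : ℝ)
    (A : Set ((Ω → ℝ) × (Ω → ℝ))) : Set ((Ω → ℝ) → (Ω → ℝ) → EReal) :=
  {D | ∃ a : ℝ, 0 < a ∧ ∀ g f, (g, f) ∈ A → D g f = (a : EReal) * jhhb μ ζ γ g f}

end

/-! For equal parameters `γ > 0`, both descriptions depend only on `A = ⟨g^(1+γ)⟩`, `B = ⟨g f^γ⟩`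
and `C = ⟨f^(1+γ)⟩`, and every positive triple with `B^(1+γ) ≤ A C^γ` occurs
(`TestPair.exists_integrals`). Let `Φ` be the finite part of the FDPD generator and `τ` the
rescaling of the Hölder score. Varying `A` alone gives `τ(-A) = k - Φ(A)/γ`. For `B = zC` with `z ≥
1`, monotonicity then forces `η(z) ≤ -1`, so `τ` is also known at `η(z)C`, and `τ` can be
eliminated. In the logarithmic variable `ψ(s) = Φ(e^s)`, with `W(u) = log(-η(e^u))`, this reads `ψ(s
+ W u) = (1+γ) ψ(s+u) - γ ψ(s)`, where `u ≥ 0` and `0 ≤ W u ≤ (1+γ)u`.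

This equation is linear, translation invariant and solved by constants. It writes `ψ(s+u)` as a
weighted mean of `ψ(s)` and `ψ(s + W u)`, which gives a maximum principle
(`nonpos_of_zero_endpoints`). So every continuous solution is an affine image of `ψ`, in particular
every translate of `ψ` is. Hence `ψ` is affine or exponential (`affine_or_exponential`), and
convexity makes the exponent positive: `Φ` is a logarithm or a power up to constants, which is the
JHHB family. Conversely, explicit `η` and `τ` exhibit each member as a Hölder divergence;
Bernoulli's inequality supplies the bound on `η`.

For parameter zero, and for different parameters, two-step test functions with equal Hölder scores
suffice: the FDPD must agree on them too. -/

/-! ### The functional equation and its solutions. -/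

/-- A continuous solution of the functional equation that vanishes at two points is nonpositive
between them. -/
theorem nonpos_of_zero_endpoints {γ : ℝ} (hγ : 0 < γ) {W G : ℝ → ℝ} (hG : Continuous G)
    (hW0 : ∀ u, 0 ≤ u → 0 ≤ W u) (hW1 : ∀ u, 0 ≤ u → W u ≤ (1 + γ) * u)
    (hGW : ∀ s u, 0 ≤ u → G (s + W u) = (1 + γ) * G (s + u) - γ * G s)
    {p q : ℝ} (hpq : p ≤ q) (hp : G p = 0) (hq : G q = 0) {x : ℝ} (hx : x ∈ Icc p q) :
    G x ≤ 0 := by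
  obtain ⟨m, hm, hmax⟩ := isCompact_Icc.exists_isMaxOn (nonempty_Icc.2 hpq) hG.continuousOn
  by_contra! hpos
  have hM : 0 < G m := hpos.trans_le (hmax hx)
  have hK : IsCompact (Icc p q ∩ G ⁻¹' {G m}) :=
    isCompact_Icc.inter_right (isClosed_singleton.preimage hG)
  -- Taking the leftmost maximum point `y` makes the inequality at `y - δ` strict.
  obtain ⟨y, ⟨hy, hyM⟩, hymin⟩ := hK.exists_isLeast ⟨m, hm, rfl⟩
  have hyM' : G y = G m := hyM
  have hpy : p < y := lt_of_le_of_ne hy.1 (by rintro rfl; linarith)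
  have hyq : y < q := lt_of_le_of_ne hy.2 (by rintro rfl; linarith)
  -- This size keeps both `y - δ` and `y - δ + W δ` inside `[p, q]`.
  set δ := min (y - p) ((q - y) / (1 + γ)) with hδ
  have hγ1 : 0 < 1 + γ := by linarith
  have hδ0 : 0 < δ := lt_min (by linarith) (div_pos (by linarith) hγ1)
  have hδ1 : δ ≤ y - p := min_le_left _ _
  have hδ2 : (1 + γ) * δ ≤ q - y := by
    have : δ ≤ (q - y) / (1 + γ) := min_le_right _ _
    rw [le_div_iff₀ hγ1] at this
    linarith
  have key := hGW (y - δ) δ hδ0.le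
  rw [sub_add_cancel, hyM'] at key
  have h1 : G (y - δ) < G m := by
    refine lt_of_le_of_ne (hmax ⟨by linarith, by linarith⟩) fun h => ?_
    have := hymin ⟨⟨by linarith, by linarith⟩, h⟩
    linarith
  have h2 : G (y - δ + W δ) ≤ G m :=
    hmax ⟨by linarith [hW0 δ hδ0.le], by linarith [hW1 δ hδ0.le]⟩
  -- The maximum is a weighted mean, with positive weights, of a value at most `G m` and one
  -- strictly below it.
  nlinarith

/-- Two continuous solutions of the functional equation are affinely related. -/
theorem exists_affine_relation {γ : ℝ} (hγ : 0 < γ) {W ψ χ : ℝ → ℝ}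
    (hψ : Continuous ψ) (hψm : StrictMono ψ) (hχ : Continuous χ)
    (hW0 : ∀ u, 0 ≤ u → 0 ≤ W u) (hW1 : ∀ u, 0 ≤ u → W u ≤ (1 + γ) * u)
    (hψW : ∀ s u, 0 ≤ u → ψ (s + W u) = (1 + γ) * ψ (s + u) - γ * ψ s)
    (hχW : ∀ s u, 0 ≤ u → χ (s + W u) = (1 + γ) * χ (s + u) - γ * χ s) (x : ℝ) :
    (χ x - χ 0) * (ψ 1 - ψ 0) = (χ 1 - χ 0) * (ψ x - ψ 0) := by
  have hloc : ∀ p q, p < q → ∀ y ∈ Icc p q,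
      (χ y - χ p) * (ψ q - ψ p) = (χ q - χ p) * (ψ y - ψ p) := by
    intro p q hpq y hy
    -- This combination vanishes at `p` and `q` and again solves the equation, by linearity and
    -- because constants are solutions. The signs `ε = ±1` give both inequalities.
    have aux : ∀ ε : ℝ, ε * ((χ y - χ p) * (ψ q - ψ p) - (χ q - χ p) * (ψ y - ψ p)) ≤ 0 := by
      intro ε
      refine nonpos_of_zero_endpoints
        (G := fun y => ε * ((χ y - χ p) * (ψ q - ψ p) - (χ q - χ p) * (ψ y - ψ p)))
        hγ (by fun_prop) hW0 hW1 ?_ hpq.le (by ring) (by ring) hy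
      intro s u hu
      simp only [hψW s u hu, hχW s u hu]
      ring
    have h1 := aux 1
    have h2 := aux (-1)
    linarith
  -- The interval `[p, q]` contains `x`, `0` and `1`; eliminating its endpoints leaves the relation
  -- normalised at `0` and `1`.
  set p := min x 0 with hp
  set q := max x 1 with hq
  have hp0 : p ≤ 0 := min_le_right _ _
  have hq1 : 1 ≤ q := le_max_right _ _
  have hpq : p < q := by linarith
  have hd : ψ q - ψ p ≠ 0 := (sub_pos.2 (hψm hpq)).ne'
  have hx := hloc p q hpq x ⟨min_le_left _ _, le_max_left _ _⟩
  have h0 := hloc p q hpq 0 ⟨hp0, by linarith⟩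
  have h1 := hloc p q hpq 1 ⟨by linarith, hq1⟩
  have e1 : (χ x - χ 0) * (ψ q - ψ p) = (χ q - χ p) * (ψ x - ψ 0) := by linarith
  have e2 : (χ 1 - χ 0) * (ψ q - ψ p) = (χ q - χ p) * (ψ 1 - ψ 0) := by linarith
  apply mul_right_cancel₀ hd
  linear_combination (ψ 1 - ψ 0) * e1 - (ψ x - ψ 0) * e2

/-- A continuous map from `(ℝ, +)` to `(ℝ, +)` respecting addition is linear. -/
theorem eq_mul_of_continuous_additive {f : ℝ → ℝ} (hf : Continuous f)
    (hadd : ∀ s t, f (s + t) = f s + f t) (t : ℝ) : f t = f 1 * t := by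
  let F : ℝ →+ ℝ := AddMonoidHom.mk' f hadd
  have h := map_real_smul F hf t 1
  simp only [smul_eq_mul, mul_one] at h
  change f t = t * f 1 at h
  rw [h, mul_comm]

/-- A strictly increasing continuous function whose translates are affine images of itself is
affine or exponential. -/
theorem affine_or_exponential {ψ : ℝ → ℝ} (hψ : Continuous ψ) (hψm : StrictMono ψ)
    (htr : ∀ t x, (ψ (x + t) - ψ t) * (ψ 1 - ψ 0) = (ψ (1 + t) - ψ t) * (ψ x - ψ 0)) :
    (∃ α β : ℝ, 0 < β ∧ ∀ s, ψ s = α + β * s) ∨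
      ∃ α κ ζ : ℝ, ζ ≠ 0 ∧ 0 < κ * ζ ∧ ∀ s, ψ s = α + κ * Real.exp (ζ * s) := by
  have hd : 0 < ψ 1 - ψ 0 := sub_pos.2 (hψm one_pos)
  set a : ℝ → ℝ := fun t => (ψ (1 + t) - ψ t) / (ψ 1 - ψ 0) with ha
  have hapos : ∀ t, 0 < a t := fun t => div_pos (sub_pos.2 (hψm (by linarith))) hd
  have hacont : Continuous a := by fun_prop
  have htr' : ∀ t x, ψ (x + t) - ψ t = a t * (ψ x - ψ 0) := by
    intro t x
    have := htr t x
    simp only [ha]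
    field_simp
    linarith
  -- The slopes of successive translations multiply, so `log a` is additive and continuous.
  have hamul : ∀ s t, a (s + t) = a s * a t := by
    intro s t
    have e1 := htr' (s + t) 1
    have e2 := htr' t (1 + s)
    have e3 := htr' t s
    have e4 := htr' s 1
    rw [← add_assoc] at e1
    apply mul_right_cancel₀ hd.ne'
    linear_combination (-1) * e1 + e2 - e3 + a t * e4
  have hlog : ∀ t, Real.log (a t) = Real.log (a 1) * t :=
    eq_mul_of_continuous_additive (f := fun t => Real.log (a t))
      (hacont.log fun t => (hapos t).ne')
      (fun s t => by
        simp only [hamul, Real.log_mul (hapos s).ne' (hapos t).ne'])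
  have haexp : ∀ t, a t = Real.exp (Real.log (a 1) * t) := fun t => by
    rw [← hlog, Real.exp_log (hapos t)]
  set ζ := Real.log (a 1)
  by_cases hζ : ζ = 0
  · left
    have hp := eq_mul_of_continuous_additive (f := fun t => ψ t - ψ 0) (by fun_prop)
      (fun s t => by
        have := htr' t s
        rw [haexp, hζ, zero_mul, Real.exp_zero] at this
        linarith)
    exact ⟨ψ 0, ψ 1 - ψ 0, hd, fun s => by linarith [hp s]⟩
  · right
    have hne : Real.exp ζ - 1 ≠ 0 := by
      rw [sub_ne_zero]
      simpa using hζ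
    -- Expanding `ψ (s + 1)` as a translate by `s` and as a translate by `1`, then comparing,
    -- determines `ψ s` since `exp ζ ≠ 1`.
    have hp : ∀ s, ψ s - ψ 0 = (ψ 1 - ψ 0) / (Real.exp ζ - 1) * (Real.exp (ζ * s) - 1) := by
      intro s
      have e1 := htr' s 1
      have e2 := htr' 1 s
      rw [add_comm 1 s] at e1
      rw [haexp s] at e1
      rw [haexp 1, mul_one] at e2
      field_simp
      linear_combination e1 - e2
    refine ⟨ψ 0 - (ψ 1 - ψ 0) / (Real.exp ζ - 1), (ψ 1 - ψ 0) / (Real.exp ζ - 1), ζ, hζ, ?_,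
      fun s => by linear_combination hp s⟩
    rw [div_mul_eq_mul_div, mul_div_assoc]
    refine mul_pos hd ?_
    rcases lt_or_gt_of_ne hζ with h | h
    · exact div_pos_of_neg_of_neg h (by simpa using h)
    · exact div_pos h (by simpa using h)

/-- Positivity of the exponent from convexity. -/
theorem exponent_pos_of_convexOn {α κ ζ : ℝ} (hζ : ζ ≠ 0) (hκ : 0 < κ * ζ)
    (hconv : ConvexOn ℝ univ fun s : ℝ => α + κ * Real.exp (ζ * s)) : 0 < ζ := by
  -- Midpoint convexity at `-1, 0, 1` says `κ ≤ κ cosh ζ`, which fails for negative `κ`.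
  have h := hconv.2 (mem_univ (-1)) (mem_univ 1) (by norm_num : (0 : ℝ) ≤ 1 / 2)
    (by norm_num : (0 : ℝ) ≤ 1 / 2) (by norm_num)
  norm_num at h
  have hc : 1 < Real.cosh ζ := Real.one_lt_cosh.2 hζ
  rw [Real.cosh_eq] at hc
  have hκ0 : 0 < κ := by
    by_contra! hle
    have : κ ≠ 0 := by rintro rfl; simp at hκ
    have hlt : κ < 0 := lt_of_le_of_ne hle this
    nlinarith
  exact pos_of_mul_pos_right hκ hκ0.le

/-- The possible generators: `Φ` and `t` are the finite parts of the generator of a functional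
density power divergence and of the rescaling of a Hölder score with the same divergence. -/
theorem generator_eq_log_or_rpow {γ : ℝ} (hγ : 0 < γ) {Φ t η : ℝ → ℝ} {V : Set ℝ}
    (hΦ : StrictMonoOn Φ (Ioi 0)) (hconv : ConvexOn ℝ univ fun s : ℝ => Φ (Real.exp s))
    (ht : StrictMonoOn t V) (hη : ∀ z, 0 ≤ z → -z ^ (1 + γ) ≤ η z)
    (hV1 : ∀ A, 0 < A → -A ∈ V)
    (hV2 : ∀ B C, 0 < B → 0 < C → η (B / C) * C ∈ V)
    (h : ∀ A B C, 0 < A → 0 < B → 0 < C → B ^ (1 + γ) ≤ A * C ^ γ →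
      1 / γ * Φ A - (1 + γ) / γ * Φ B + Φ C = t (η (B / C) * C) - t (-A)) :
    (∃ α β : ℝ, 0 < β ∧ ∀ x, 0 < x → Φ x = α + β * Real.log x) ∨
      ∃ α κ ζ : ℝ, 0 < ζ ∧ 0 < κ ∧ ∀ x, 0 < x → Φ x = α + κ * x ^ ζ := by
  have hγ1 : 0 < 1 + γ := by linarith
  obtain ⟨k, hk⟩ : ∃ k, ∀ A, 0 < A → t (-A) = k - 1 / γ * Φ A := by
    refine ⟨t (-1) + 1 / γ * Φ 1, fun A hA => ?_⟩
    -- With this `B` and `C = 1`, both `A` and `1` are admissible first entries; subtracting the two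
    -- identities cancels all terms in `B` and `C`.
    set B := (min A 1) ^ (1 + γ)⁻¹ with hB
    have hm : 0 < min A 1 := lt_min hA one_pos
    have hB0 : 0 < B := Real.rpow_pos_of_pos hm _
    have hBp : B ^ (1 + γ) = min A 1 := Real.rpow_inv_rpow hm.le hγ1.ne'
    have e1 := h A B 1 hA hB0 one_pos (by rw [hBp, Real.one_rpow, mul_one]; exact min_le_left _ _)
    have e2 := h 1 B 1 one_pos hB0 one_pos
      (by rw [hBp, Real.one_rpow, mul_one]; exact min_le_right _ _)
    linarith
  have hmain : ∀ z C, 1 ≤ z → 0 < C →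
      1 ≤ -η z ∧ Φ (-η z * C) = (1 + γ) * Φ (z * C) - γ * Φ C := by
    intro z C hz hC
    have hz0 : 0 < z := by linarith
    have hzC : 0 < z * C := mul_pos hz0 hC
    -- The first entry is the equality case of Hölder's inequality; its contribution cancels through
    -- `hk`.
    have e1 := h (z ^ (1 + γ) * C) (z * C) C (mul_pos (Real.rpow_pos_of_pos hz0 _) hC) hzC hC
      (le_of_eq (by rw [Real.mul_rpow hz0.le hC.le, Real.rpow_add hC, Real.rpow_one, mul_assoc]))
    rw [hk _ (mul_pos (Real.rpow_pos_of_pos hz0 _) hC), mul_div_cancel_right₀ _ hC.ne'] at e1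
    have hVm : η z * C ∈ V := by
      have := hV2 (z * C) C hzC hC
      rwa [mul_div_cancel_right₀ _ hC.ne'] at this
    have hle : Φ C ≤ Φ (z * C) := hΦ.monotoneOn hC hzC (by nlinarith)
    have e2 : t (η z * C) = k - (1 + γ) / γ * Φ (z * C) + Φ C := by linarith
    have e3 : t (η z * C) ≤ t (-C) := by
      rw [hk C hC, e2]
      have : (1 + γ) / γ = 1 / γ + 1 := by field_simp
      rw [this]
      have := mul_le_mul_of_nonneg_left hle (by positivity : 0 ≤ 1 / γ + 1)
      linarith
    have e4 : η z * C ≤ -C := (ht.le_iff_le hVm (hV1 C hC)).1 e3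
    have e5 : 1 ≤ -η z := by
      have : 1 * C ≤ -η z * C := by linarith
      exact le_of_mul_le_mul_right this hC
    refine ⟨e5, ?_⟩
    -- As `-η z ≥ 1`, the score `η z * C` is also the score of a diagonal pair, where `τ` is given
    -- by `hk`.
    have e6 := hk (-η z * C) (mul_pos (by linarith) hC)
    rw [neg_mul, neg_neg, e2] at e6
    have e7 : (1 + γ) / γ = 1 / γ * (1 + γ) := by ring
    have e8 : γ * (1 / γ) = 1 := by field_simp
    rw [neg_mul]
    rw [e7] at e6
    linear_combination γ * e6 + ((1 + γ) * Φ (z * C) - Φ (-(η z * C))) * e8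
  set ψ : ℝ → ℝ := fun s => Φ (Real.exp s) with hψ
  have hψc : Continuous ψ := by
    rw [← continuousOn_univ]
    exact hconv.continuousOn isOpen_univ
  have hψm : StrictMono ψ := fun x y hxy =>
    hΦ (Real.exp_pos _) (Real.exp_pos _) (Real.exp_lt_exp.2 hxy)
  set W : ℝ → ℝ := fun u => Real.log (-η (Real.exp u)) with hW
  have hη1 : ∀ u, 0 ≤ u → 1 ≤ -η (Real.exp u) := fun u hu =>
    (hmain _ 1 (Real.one_le_exp hu) one_pos).1
  have hW0 : ∀ u, 0 ≤ u → 0 ≤ W u := fun u hu => Real.log_nonneg (hη1 u hu)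
  have hW1 : ∀ u, 0 ≤ u → W u ≤ (1 + γ) * u := fun u hu => by
    have h1 : -η (Real.exp u) ≤ Real.exp u ^ (1 + γ) := by
      linarith [hη (Real.exp u) (Real.exp_pos _).le]
    have h2 := Real.log_le_log (by linarith [hη1 u hu]) h1
    rwa [Real.log_rpow (Real.exp_pos _), Real.log_exp] at h2
  have hψW : ∀ s u, 0 ≤ u → ψ (s + W u) = (1 + γ) * ψ (s + u) - γ * ψ s := by
    intro s u hu
    have := (hmain _ (Real.exp s) (Real.one_le_exp hu) (Real.exp_pos _)).2
    simp only [hψ, hW]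
    rw [Real.exp_add, Real.exp_add, Real.exp_log (by linarith [hη1 u hu]), mul_comm (Real.exp s),
      mul_comm (Real.exp s), this]
  -- Translates of `ψ` solve the same equation, with the same `W`.
  have htr : ∀ t x, (ψ (x + t) - ψ t) * (ψ 1 - ψ 0) = (ψ (1 + t) - ψ t) * (ψ x - ψ 0) := by
    intro t x
    have := exists_affine_relation (χ := fun s => ψ (s + t)) hγ hψc hψm (by fun_prop) hW0 hW1 hψW
      (fun s u hu => by
        have := hψW (s + t) u hu
        rw [show s + W u + t = s + t + W u by ring, this, show s + t + u = s + u + t by ring]) x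
    simpa using this
  have hlog : ∀ x, 0 < x → Φ x = ψ (Real.log x) := fun x hx => by
    simp only [hψ, Real.exp_log hx]
  rcases affine_or_exponential hψc hψm htr with ⟨α, β, hβ, hs⟩ | ⟨α, κ, ζ, hζ, hκζ, hs⟩
  · exact Or.inl ⟨α, β, hβ, fun x hx => by rw [hlog x hx, hs]⟩
  · have hζ0 : 0 < ζ := exponent_pos_of_convexOn (α := α) hζ hκζ (by
      rw [← funext hs]
      exact hconv)
    refine Or.inr ⟨α, κ, ζ, hζ0, pos_of_mul_pos_left hκζ hζ0.le, fun x hx => ?_⟩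
    rw [hlog x hx, hs, Real.rpow_def_of_pos hx, mul_comm ζ]

/-! ### Disjoint sets of positive measure. -/

/-- A set of nonzero measure contains a point all of whose neighbourhoods meet it in positive
measure. Without atoms, deleting that point leaves another such point, and Hausdorff separation of
the two gives the pieces. -/
theorem exists_split_of_measure_ne_zero {Ω : Type*} [TopologicalSpace Ω] [T2Space Ω]
    [SecondCountableTopology Ω] [MeasurableSpace Ω] [BorelSpace Ω] {μ : Measure Ω} [NullSingletonClass μ]
    {s : Set Ω} (hs : MeasurableSet s) (h0 : μ s ≠ 0) :
    ∃ u v, MeasurableSet u ∧ MeasurableSet v ∧ u ⊆ s ∧ v ⊆ s ∧ Disjoint u v ∧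
      μ u ≠ 0 ∧ μ v ≠ 0 := by
  obtain ⟨x, -, hx⟩ := exists_mem_forall_mem_nhdsWithin_pos_measure h0
  have h1 : μ (s \ {x}) ≠ 0 := by rwa [measure_sdiff_null (measure_singleton x)]
  obtain ⟨y, hy, hy'⟩ := exists_mem_forall_mem_nhdsWithin_pos_measure h1
  have hne : x ≠ y := fun h => hy.2 h.symm
  obtain ⟨U, V, hU, hV, hxU, hyV, hUV⟩ := t2_separation hne
  refine ⟨s ∩ U, s ∩ V, hs.inter hU.measurableSet, hs.inter hV.measurableSet, inter_subset_left,
    inter_subset_left, hUV.mono inter_subset_right inter_subset_right,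
    (hx _ (inter_mem_nhdsWithin s (hU.mem_nhds hxU))).ne', ?_⟩
  refine ((hy' _ (inter_mem_nhdsWithin _ (hV.mem_nhds hyV))).trans_le (measure_mono ?_)).ne'
  exact inter_subset_inter_left _ sdiff_subset

/-- A nonzero, σ-finite, atomless Borel measure charges three disjoint sets. -/
theorem exists_three_disjoint {Ω : Type*} [TopologicalSpace Ω] [T2Space Ω]
    [SecondCountableTopology Ω] [MeasurableSpace Ω] [BorelSpace Ω] {μ : Measure Ω} [NullSingletonClass μ]
    [SigmaFinite μ] (h0 : μ univ ≠ 0) :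
    ∃ E₁ E₂ E₃, MeasurableSet E₁ ∧ MeasurableSet E₂ ∧ MeasurableSet E₃ ∧
      Disjoint E₁ E₂ ∧ Disjoint E₁ E₃ ∧ Disjoint E₂ E₃ ∧
      μ E₁ ≠ ⊤ ∧ μ E₂ ≠ ⊤ ∧ μ E₃ ≠ ⊤ ∧ 0 < μ.real E₁ ∧ 0 < μ.real E₂ ∧ 0 < μ.real E₃ := by
  obtain ⟨n, hn⟩ : ∃ n, μ (spanningSets μ n) ≠ 0 := by
    by_contra! h
    exact h0 (by rw [← iUnion_spanningSets μ]; exact measure_iUnion_null h)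
  have hfin : ∀ t ⊆ spanningSets μ n, μ t ≠ ⊤ := fun t ht =>
    ((measure_mono ht).trans_lt (measure_spanningSets_lt_top μ n)).ne
  obtain ⟨u, v, hu, hv, hus, hvs, huv, hu0, hv0⟩ :=
    exists_split_of_measure_ne_zero (measurableSet_spanningSets μ n) hn
  obtain ⟨a, b, ha, hb, hav, hbv, hab, ha0, hb0⟩ := exists_split_of_measure_ne_zero hv hv0
  exact ⟨u, a, b, hu, ha, hb, huv.mono_right hav, huv.mono_right hbv, hab, hfin _ hus,
    hfin _ (hav.trans hvs), hfin _ (hbv.trans hvs),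
    ENNReal.toReal_pos hu0 (hfin _ hus), ENNReal.toReal_pos ha0 (hfin _ (hav.trans hvs)),
    ENNReal.toReal_pos hb0 (hfin _ (hbv.trans hvs))⟩

/-! ### Two-step test functions and their integrals. -/

open Classical in
/-- The function with value `a` on `E`, value `b` on `F \ E`, and `0` elsewhere. -/
noncomputable def twoStep {Ω : Type*} (E F : Set Ω) (a b : ℝ) : Ω → ℝ :=
  fun x => if x ∈ E then a else if x ∈ F then b else 0

theorem twoStep_comp₂ {Ω : Type*} {E F : Set Ω} (k : ℝ → ℝ → ℝ) (hk : k 0 0 = 0) (a b c e : ℝ) :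
    (fun x => k (twoStep E F a b x) (twoStep E F c e x)) = twoStep E F (k a c) (k b e) := by
  funext x
  unfold twoStep
  split_ifs <;> simp [hk]

theorem twoStep_comp {Ω : Type*} {E F : Set Ω} (k : ℝ → ℝ) (hk : k 0 = 0) (a b : ℝ) :
    (fun x => k (twoStep E F a b x)) = twoStep E F (k a) (k b) :=
  twoStep_comp₂ (fun x _ => k x) hk a b 0 0

theorem twoStep_eq_indicator {Ω : Type*} {E F : Set Ω} (hd : Disjoint E F) (a b : ℝ) :
    twoStep E F a b = fun x => E.indicator (fun _ => a) x + F.indicator (fun _ => b) x := by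
  funext x
  unfold twoStep
  by_cases hE : x ∈ E
  · simp [hE, disjoint_left.1 hd hE]
  · simp [hE, indicator]

section
variable {Ω : Type*} [MeasurableSpace Ω] {μ : Measure Ω} {E F : Set Ω}

theorem measurable_twoStep (hE : MeasurableSet E) (hF : MeasurableSet F) (a b : ℝ) :
    Measurable (twoStep E F a b) :=
  Measurable.ite hE measurable_const (Measurable.ite hF measurable_const measurable_const)

theorem integrable_twoStep (hE : MeasurableSet E) (hF : MeasurableSet F) (hd : Disjoint E F)
    (hEt : μ E ≠ ⊤) (hFt : μ F ≠ ⊤) (a b : ℝ) : Integrable (twoStep E F a b) μ := by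
  rw [twoStep_eq_indicator hd]
  exact ((integrable_indicator_iff hE).2 (integrableOn_const hEt)).add
    ((integrable_indicator_iff hF).2 (integrableOn_const hFt))

theorem integral_twoStep (hE : MeasurableSet E) (hF : MeasurableSet F) (hd : Disjoint E F)
    (hEt : μ E ≠ ⊤) (hFt : μ F ≠ ⊤) (a b : ℝ) :
    ∫ x, twoStep E F a b x ∂μ = μ.real E * a + μ.real F * b := by
  rw [twoStep_eq_indicator hd, integral_add ((integrable_indicator_iff hE).2 (integrableOn_const hEt))
    ((integrable_indicator_iff hF).2 (integrableOn_const hFt)), integral_indicator_const _ hE,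
    integral_indicator_const _ hF, smul_eq_mul, smul_eq_mul]

/-- A pair of disjoint measurable sets of finite positive measure. -/
structure TestPair (μ : Measure Ω) (E F : Set Ω) : Prop where
  measurableSet_left : MeasurableSet E
  measurableSet_right : MeasurableSet F
  disjoint : Disjoint E F
  left_ne_top : μ E ≠ ⊤
  right_ne_top : μ F ≠ ⊤
  left_pos : 0 < μ.real E
  right_pos : 0 < μ.real F

namespace TestPair
variable (h : TestPair μ E F)
include h

theorem integrable_comp₂ (k : ℝ → ℝ → ℝ) (hk : k 0 0 = 0) (a b c e : ℝ) :
    Integrable (fun x => k (twoStep E F a b x) (twoStep E F c e x)) μ := by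
  rw [twoStep_comp₂ k hk]
  exact integrable_twoStep h.1 h.2 h.3 h.4 h.5 _ _

theorem integral_comp₂ (k : ℝ → ℝ → ℝ) (hk : k 0 0 = 0) (a b c e : ℝ) :
    ∫ x, k (twoStep E F a b x) (twoStep E F c e x) ∂μ =
      μ.real E * k a c + μ.real F * k b e := by
  rw [twoStep_comp₂ k hk]
  exact integral_twoStep h.1 h.2 h.3 h.4 h.5 _ _

theorem integral_comp (k : ℝ → ℝ) (hk : k 0 = 0) (a b : ℝ) :
    ∫ x, k (twoStep E F a b x) ∂μ = μ.real E * k a + μ.real F * k b := by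
  rw [twoStep_comp k hk]
  exact integral_twoStep h.1 h.2 h.3 h.4 h.5 _ _

theorem memF {γ : ℝ} (hγ : 0 ≤ γ) {a b : ℝ} (ha : 0 < a) (hb : 0 ≤ b) :
    MemF μ γ (twoStep E F a b) where
  measurable := measurable_twoStep h.1 h.2 a b
  nonneg x := by
    unfold twoStep
    split_ifs <;> linarith
  ne_zero h0 := by
    have h1 := integral_congr_ae h0
    rw [integral_twoStep h.1 h.2 h.3 h.4 h.5] at h1
    simp only [Pi.zero_apply, integral_zero] at h1
    nlinarith [mul_pos h.left_pos ha, mul_nonneg h.right_pos.le hb]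
  integrable := h.integrable_comp₂ (fun x _ => x ^ (1 + γ)) (Real.zero_rpow (by linarith)) a b 0 0

theorem mem_Dom {γ : ℝ} (hγ : 0 ≤ γ) {a c e : ℝ} (ha : 0 < a) (hc : 0 < c) (he : 0 ≤ e) :
    (twoStep E F a 0, twoStep E F c e) ∈ Dom μ γ := by
  refine ⟨h.memF hγ ha le_rfl, h.memF hγ hc he, fun _ => ⟨?_, ?_, ?_⟩⟩
  · exact h.integrable_comp₂ (fun x y => x * Real.log y) (by simp) a 0 c e
  · exact h.integrable_comp₂ (fun x _ => x * Real.log x) (by simp) a 0 c e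
  · refine Filter.Eventually.of_forall fun x => ?_
    simp only [twoStep]
    split_ifs <;> intro h0 <;> simp_all

end TestPair

theorem MemF.integral_pos {γ : ℝ} {f : Ω → ℝ} (hγ : 0 ≤ γ) (hf : MemF μ γ f) :
    0 < ∫ x, f x ^ (1 + γ) ∂μ := by
  have hnn : ∀ x, 0 ≤ f x ^ (1 + γ) := fun x => Real.rpow_nonneg (hf.nonneg x) _
  refine lt_of_le_of_ne (integral_nonneg hnn) fun h0 => hf.ne_zero ?_
  have h1 := (integral_eq_zero_iff_of_nonneg hnn hf.integrable).1 h0.symm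
  filter_upwards [h1] with x hx
  exact (Real.rpow_eq_zero (hf.nonneg x) (by linarith)).1 hx

theorem MemF.mul_rpow_self {γ : ℝ} {f : Ω → ℝ} (hγ : 0 < γ) (hf : MemF μ γ f) :
    (fun x => f x * f x ^ γ) = fun x => f x ^ (1 + γ) := by
  funext x
  rw [Real.rpow_add' (hf.nonneg x) (by linarith), Real.rpow_one]

theorem MemF.integral_mul_rpow_nonneg {γ : ℝ} {g f : Ω → ℝ} (hg : MemF μ γ g) (hf : MemF μ γ f) :
    0 ≤ ∫ x, g x * f x ^ γ ∂μ :=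
  integral_nonneg fun x => mul_nonneg (hg.nonneg x) (Real.rpow_nonneg (hf.nonneg x) _)

/-- Every triple of positive numbers allowed by Hölder's inequality is a triple of integrals. -/
theorem TestPair.exists_integrals {γ : ℝ} (h : TestPair μ E F) (hγ : 0 < γ) {A B C : ℝ}
    (hA : 0 < A) (hB : 0 < B) (hC : 0 < C) (hABC : B ^ (1 + γ) ≤ A * C ^ γ) :
    ∃ g f, (g, f) ∈ Dom μ γ ∧ ∫ x, g x ^ (1 + γ) ∂μ = A ∧ ∫ x, g x * f x ^ γ ∂μ = B ∧
      ∫ x, f x ^ (1 + γ) ∂μ = C := by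
  have hγ1 : 0 < 1 + γ := by linarith
  set m := μ.real E with hm
  set n := μ.real F with hn
  have hm0 : 0 < m := h.left_pos
  have hn0 : 0 < n := h.right_pos
  -- The functions are `g = a` on `E`, and `f = c` on `E`, `f = e` on `F`. Then `a`, `c`, `e` are
  -- solved from `A`, `B`, `C` in turn; the assumed inequality is what makes the remaining mass for
  -- `e` nonnegative.
  set a := (A / m) ^ (1 + γ)⁻¹ with ha
  have ha0 : 0 < a := by positivity
  have hap : a ^ (1 + γ) = A / m := Real.rpow_inv_rpow (by positivity) hγ1.ne'
  set c := (B / (m * a)) ^ γ⁻¹ with hc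
  have hc0 : 0 < c := by positivity
  have hcp : c ^ γ = B / (m * a) := Real.rpow_inv_rpow (by positivity) hγ.ne'
  have hcC : m * c ^ (1 + γ) ≤ C := by
    rw [← Real.rpow_le_rpow_iff (by positivity) hC.le hγ, Real.mul_rpow hm0.le (by positivity),
      ← Real.rpow_mul hc0.le, mul_comm (1 + γ), Real.rpow_mul hc0.le, hcp,
      Real.div_rpow hB.le (by positivity), Real.mul_rpow hm0.le ha0.le, hap,
      Real.rpow_add hm0 1 γ, Real.rpow_one]
    have : 0 < m ^ γ := by positivity
    calc m ^ γ * (B ^ (1 + γ) / (m * m ^ γ * (A / m))) = B ^ (1 + γ) / A := by field_simp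
      _ ≤ C ^ γ := by rw [div_le_iff₀ hA]; linarith
  set e := ((C - m * c ^ (1 + γ)) / n) ^ (1 + γ)⁻¹ with he
  have he' : 0 ≤ (C - m * c ^ (1 + γ)) / n := div_nonneg (by linarith) hn0.le
  have he0 : 0 ≤ e := Real.rpow_nonneg he' _
  have hep : e ^ (1 + γ) = (C - m * c ^ (1 + γ)) / n := Real.rpow_inv_rpow he' hγ1.ne'
  refine ⟨twoStep E F a 0, twoStep E F c e, h.mem_Dom hγ.le ha0 hc0 he0, ?_, ?_, ?_⟩
  · rw [h.integral_comp (fun x => x ^ (1 + γ)) (Real.zero_rpow hγ1.ne'), hap,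
      Real.zero_rpow hγ1.ne', ← hm]
    field_simp
    ring
  · rw [h.integral_comp₂ (fun x y => x * y ^ γ) (zero_mul _), hcp, ← hm]
    field_simp
    ring
  · rw [h.integral_comp (fun x => x ^ (1 + γ)) (Real.zero_rpow hγ1.ne'), hep, ← hm, ← hn]
    field_simp
    ring
end

/-! ### Finite values of generators, divergences and scores. -/

theorem EReal.exists_coe_of_sub_eq_coe {x y : EReal} {r : ℝ} (h : x - y = r) :
    ∃ a b : ℝ, x = a ∧ y = b ∧ a - b = r := by
  induction x <;> induction y <;> simp_all
  exact_mod_cast h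

theorem IsFDPDGenerator.coe_toReal {γ : ℝ} {φ : ℝ → EReal} (hφ : IsFDPDGenerator γ φ) {x : ℝ}
    (hx : 0 < x) : ((φ x).toReal : EReal) = φ x := by
  have h0 : φ 0 < φ x := hφ.strictMonoOn self_mem_Ici hx.le hx
  have h1 : φ x < φ (x + 1) :=
    hφ.strictMonoOn hx.le (show (0 : ℝ) ≤ x + 1 by linarith) (by linarith)
  exact EReal.coe_toReal (ne_top_of_lt h1) (ne_bot_of_gt h0)

theorem IsFDPDGenerator.strictMonoOn_toReal {γ : ℝ} {φ : ℝ → EReal} (hφ : IsFDPDGenerator γ φ) :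
    StrictMonoOn (fun x => (φ x).toReal) (Ioi 0) := by
  intro x hx y hy hxy
  rw [← EReal.coe_lt_coe_iff, hφ.coe_toReal hx, hφ.coe_toReal hy]
  exact hφ.strictMonoOn (mem_Ici_of_Ioi hx) (mem_Ici_of_Ioi hy) hxy

section
variable {Ω : Type*} [MeasurableSpace Ω] {μ : Measure Ω} {E F : Set Ω}

theorem fdpd_eq_coe {φ : ℝ → EReal} {γ : ℝ} (hγ : γ ≠ 0) {g f : Ω → ℝ} {A B C : ℝ}
    (hA : φ (∫ x, g x ^ (1 + γ) ∂μ) = A) (hB : φ (∫ x, g x * f x ^ γ ∂μ) = B)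
    (hC : φ (∫ x, f x ^ (1 + γ) ∂μ) = C) :
    fdpd μ φ γ g f = ((1 / γ * A - (1 + γ) / γ * B + C : ℝ) : EReal) := by
  rw [fdpd, if_neg hγ, hA, hB, hC]
  norm_cast

theorem fdpd_zero_eq_coe {φ : ℝ → EReal} {g f : Ω → ℝ} {A C : ℝ}
    (hA : φ (∫ x, g x ∂μ) = A) (hC : φ (∫ x, f x ∂μ) = C) :
    fdpd μ φ 0 g f = ((deriv (fun z => (φ z).toReal) (∫ x, g x ∂μ) *
      (∫ x, g x * Real.log (g x / f x) ∂μ) - A + C : ℝ) : EReal) := by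
  rw [fdpd, if_pos rfl, hA, hC]
  norm_cast

theorem holderScore_self {η : ℝ → ℝ} {γ : ℝ} (hγ : 0 < γ) (hη : η 1 = -1) {g : Ω → ℝ}
    (hg : MemF μ γ g) : holderScore μ η γ g g = -∫ x, g x ^ (1 + γ) ∂μ := by
  rw [holderScore, if_neg hγ.ne', hg.mul_rpow_self hγ, div_self (hg.integral_pos hγ.le).ne', hη]
  ring

/-! ### Different parameters -/

/-- Since `f = 1` where `g = 1`, the cross term is `φ` of the mass of `E` (or the logarithmic
integral vanishes), so the divergence sees `f` only through `⟨f^(1+γ)⟩`. -/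
theorem TestPair.fdpd_one (h : TestPair μ E F) {φ : ℝ → EReal} {γ : ℝ} (hγ : 0 ≤ γ)
    (hφ : IsFDPDGenerator γ φ) {b : ℝ} (hb : 0 < b) :
    fdpd μ φ γ (twoStep E F 1 0) (twoStep E F 1 b) =
      ((-(φ (μ.real E)).toReal + (φ (μ.real E + μ.real F * b ^ (1 + γ))).toReal : ℝ) : EReal) := by
  have hm := h.left_pos
  have hn := h.right_pos
  have hC : 0 < μ.real E + μ.real F * b ^ (1 + γ) := by positivity
  rcases hγ.eq_or_lt with rfl | hγ
  · have e1 : ∫ x, twoStep E F 1 0 x ∂μ = μ.real E := by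
      rw [h.integral_comp (fun x => x) rfl]; ring
    have e2 : ∫ x, twoStep E F 1 b x ∂μ = μ.real E + μ.real F * b ^ ((1 : ℝ) + 0) := by
      rw [h.integral_comp (fun x => x) rfl, add_zero, Real.rpow_one]; ring
    rw [fdpd_zero_eq_coe (A := (φ (μ.real E)).toReal)
      (C := (φ (μ.real E + μ.real F * b ^ ((1 : ℝ) + 0))).toReal) (by rw [e1, hφ.coe_toReal hm]) (by rw [e2, hφ.coe_toReal hC]),
      h.integral_comp₂ (fun x y => x * Real.log (x / y)) (zero_mul _)]
    norm_num
  · have hp : (1 + γ) ≠ 0 := by positivity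
    have e1 : ∫ x, twoStep E F 1 0 x ^ (1 + γ) ∂μ = μ.real E := by
      rw [h.integral_comp (fun x => x ^ (1 + γ)) (Real.zero_rpow hp), Real.zero_rpow hp,
        Real.one_rpow]; ring
    have e2 : ∫ x, twoStep E F 1 b x ^ (1 + γ) ∂μ = μ.real E + μ.real F * b ^ (1 + γ) := by
      rw [h.integral_comp (fun x => x ^ (1 + γ)) (Real.zero_rpow hp), Real.one_rpow]; ring
    have e3 : ∫ x, twoStep E F 1 0 x * twoStep E F 1 b x ^ γ ∂μ = μ.real E := by
      rw [h.integral_comp₂ (fun x y => x * y ^ γ) (zero_mul _), Real.one_rpow]; ring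
    rw [fdpd_eq_coe hγ.ne' (A := (φ (μ.real E)).toReal) (B := (φ (μ.real E)).toReal)
      (C := (φ (μ.real E + μ.real F * b ^ (1 + γ))).toReal) (by rw [e1, hφ.coe_toReal hm])
      (by rw [e3, hφ.coe_toReal hm]) (by rw [e2, hφ.coe_toReal hC]), EReal.coe_eq_coe_iff]
    field_simp
    ring

theorem TestPair.holderScore_one (h : TestPair μ E F) (η : ℝ → ℝ) {γ : ℝ} (hγ : 0 ≤ γ) (b : ℝ) :
    holderScore μ η γ (twoStep E F 1 0) (twoStep E F 1 b) =
      if γ = 0 then μ.real E + μ.real F * b ^ (1 + γ) else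
        η (μ.real E / (μ.real E + μ.real F * b ^ (1 + γ))) *
          (μ.real E + μ.real F * b ^ (1 + γ)) := by
  have hp : (1 + γ) ≠ 0 := by positivity
  unfold holderScore
  split_ifs with h0
  · rw [h.integral_comp₂ (fun x y => x * Real.log y) (zero_mul _),
      h.integral_comp (fun x => x) rfl]
    simp [h0]
  · rw [h.integral_comp (fun x => x ^ (1 + γ)) (Real.zero_rpow hp), Real.one_rpow,
      h.integral_comp₂ (fun x y => x * y ^ γ) (zero_mul _), Real.one_rpow]
    simp

/-- For `g` the indicator of `E` and `f = 1` on `E`, the score sees only `⟨f^(1+γ₂)⟩`, while the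
divergence determines `⟨f^(1+γ₁)⟩`. Spreading mass over a second set of different measure preserves
the former and changes the latter. -/
theorem fdpd_inter_holder_eq_empty {F' : Set Ω} (h : TestPair μ E F) (h' : TestPair μ E F')
    (hne : μ.real F ≠ μ.real F') {γ₁ γ₂ : ℝ} (hγ₁ : 0 ≤ γ₁) (hγ₂ : 0 ≤ γ₂) (hγ : γ₁ ≠ γ₂) :
    fdpdFamily μ γ₁ (Dom μ γ₁ ∩ Dom μ γ₂) ∩ holderFamily μ γ₂ (Dom μ γ₁ ∩ Dom μ γ₂) = ∅ := by
  rw [eq_empty_iff_forall_notMem]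
  rintro D ⟨⟨φ, hφ, hDφ⟩, η, -, S, ⟨τ, -, hSτ⟩, hDS⟩
  have hm := h.left_pos
  have hn := h.right_pos
  have hn' := h'.right_pos
  set m := μ.real E
  set n := μ.real F
  set n' := μ.real F'
  -- Chosen so that `n' * e ^ (1 + γ₂) = n`, which equalises the two scores; `e ≠ 1` because `n ≠
  -- n'`.
  set e := (n / n') ^ (1 + γ₂)⁻¹ with he
  have he0 : 0 < e := by positivity
  have hep : e ^ (1 + γ₂) = n / n' := Real.rpow_inv_rpow (by positivity) (by positivity)
  have hmem := fun γ (hγ : 0 ≤ γ) => h.mem_Dom hγ one_pos one_pos zero_le_one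
  have hmem' := fun γ (hγ : 0 ≤ γ) => h'.mem_Dom hγ one_pos one_pos he0.le
  have hg : twoStep E F' 1 0 = twoStep E F 1 0 := by
    funext x
    simp [twoStep]
  have hscore : holderScore μ η γ₂ (twoStep E F 1 0) (twoStep E F 1 1) =
      holderScore μ η γ₂ (twoStep E F 1 0) (twoStep E F' 1 e) := by
    rw [h.holderScore_one η hγ₂, ← hg, h'.holderScore_one η hγ₂, Real.one_rpow, hep,
      mul_div_cancel₀ _ hn'.ne', mul_one]
  rw [hg] at hmem'
  have hA := And.intro (hmem γ₁ hγ₁) (hmem γ₂ hγ₂)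
  have hA' := And.intro (hmem' γ₁ hγ₁) (hmem' γ₂ hγ₂)
  have hD : D (twoStep E F 1 0) (twoStep E F 1 1) = D (twoStep E F 1 0) (twoStep E F' 1 e) := by
    rw [hDS _ _ hA, hDS _ _ hA', hSτ _ _ hA, hSτ _ _ hA', hscore]
  rw [hDφ _ _ hA, hDφ _ _ hA', h.fdpd_one hγ₁ hφ one_pos, ← hg, h'.fdpd_one hγ₁ hφ he0,
    EReal.coe_eq_coe_iff, add_right_inj] at hD
  have hinj := hφ.strictMonoOn_toReal.injOn
    (show 0 < m + n * (1 : ℝ) ^ (1 + γ₁) by positivity)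
    (show 0 < m + n' * e ^ (1 + γ₁) by positivity) hD
  rw [Real.one_rpow, mul_one, add_right_inj] at hinj
  have heq : e ^ (1 + γ₁) = e ^ (1 + γ₂) := by
    rw [hep, hinj, mul_div_cancel_left₀ _ hn'.ne']
  have he1 : e ≠ 1 := by
    intro h1
    rw [h1, Real.one_rpow, eq_comm, div_eq_one_iff_eq hn'.ne'] at hep
    exact hne hep
  have := (Real.rpow_right_inj he0 he1).1 heq
  exact hγ (by linarith)

/-! ### The parameter zero -/

theorem MemF.integral_pos_zero {f : Ω → ℝ} (hf : MemF μ 0 f) : 0 < ∫ x, f x ∂μ := by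
  simpa using hf.integral_pos le_rfl

theorem integral_mul_log_div {g f : Ω → ℝ} (h : (g, f) ∈ Dom μ 0) :
    ∫ x, g x * Real.log (g x / f x) ∂μ =
      (∫ x, g x * Real.log (g x) ∂μ) - ∫ x, g x * Real.log (f x) ∂μ := by
  obtain ⟨-, -, h3⟩ := h
  obtain ⟨h4, h5, h6⟩ := h3 rfl
  rw [← integral_sub h5 h4]
  refine integral_congr_ae ?_
  filter_upwards [h6] with x hx
  change f x = 0 → g x = 0 at hx
  by_cases hg : g x = 0
  · simp [hg]
  · rw [Real.log_div hg fun hf => hg (hx hf)]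
    ring

theorem jhhb_one_zero (g f : Ω → ℝ) :
    jhhb μ 1 0 g f =
      (((∫ x, g x * Real.log (g x / f x) ∂μ) - (∫ x, g x ∂μ) + ∫ x, f x ∂μ : ℝ) : EReal) := by
  simp [jhhb]

/-- On a level set of the score, `-m log c` equals a constant minus the total mass `x = m c + n e`,
so `Φ x - d x` is constant there. Any two masses occur together on a sufficiently high level. -/
theorem TestPair.affine_of_parameter_zero (h : TestPair μ E F) {Φ : ℝ → ℝ} {d : ℝ}
    (hΦ : ∀ c e c' e', 0 < c → 0 ≤ e → 0 < c' → 0 ≤ e' →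
      -(μ.real E * Real.log c) + (μ.real E * c + μ.real F * e) =
        -(μ.real E * Real.log c') + (μ.real E * c' + μ.real F * e') →
      d * -(μ.real E * Real.log c) + Φ (μ.real E * c + μ.real F * e) =
        d * -(μ.real E * Real.log c') + Φ (μ.real E * c' + μ.real F * e')) :
    ∃ b, ∀ x, 0 < x → Φ x = d * x + b := by
  have hm := h.left_pos
  have hn := h.right_pos
  set m := μ.real E
  set n := μ.real F
  have key : ∀ x y, 0 < x → 0 < y → Φ x - d * x = Φ y - d * y := by
    intro x y hx hy
    obtain ⟨v, hv1, hv2⟩ : ∃ v, x - m * Real.log (x / m) ≤ v ∧ y - m * Real.log (y / m) ≤ v :=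
      ⟨_, le_max_left _ _, le_max_right _ _⟩
    have aux : ∀ z, 0 < z → z - m * Real.log (z / m) ≤ v → ∃ c e, 0 < c ∧ 0 ≤ e ∧
        m * c + n * e = z ∧ m * Real.log c = z - v := by
      intro z hz hzv
      -- The level `v` and the mass `z` fix `c`, and `e` supplies the missing mass; `e ≥ 0` is
      -- exactly the assumed lower bound on `v`.
      refine ⟨Real.exp ((z - v) / m), (z - m * Real.exp ((z - v) / m)) / n, Real.exp_pos _, ?_, ?_, ?_⟩
      · refine div_nonneg ?_ hn.le
        have h1 : (z - v) / m ≤ Real.log (z / m) := by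
          rw [div_le_iff₀ hm]
          linarith
        have h2 : Real.exp ((z - v) / m) ≤ z / m := by
          rwa [← Real.le_log_iff_exp_le (by positivity)]
        rw [le_div_iff₀ hm] at h2
        linarith
      · field_simp
        ring
      · rw [Real.log_exp]
        field_simp
    obtain ⟨c, e, hc, he, h1, h2⟩ := aux x hx hv1
    obtain ⟨c', e', hc', he', h1', h2'⟩ := aux y hy hv2
    have := hΦ c e c' e' hc he hc' he' (by rw [h1, h1', h2, h2']; ring)
    rw [h1, h1', h2, h2'] at this
    linarith
  exact ⟨Φ 1 - d * 1, fun x hx => by linarith [key x 1 hx one_pos]⟩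

theorem fdpd_inter_holder_zero (h : TestPair μ E F) :
    fdpdFamily μ 0 (Dom μ 0) ∩ holderFamily μ 0 (Dom μ 0) = jhhbFamily μ 1 0 (Dom μ 0) := by
  apply Subset.antisymm
  · rintro D ⟨⟨φ, hφ, hDφ⟩, η, -, S, ⟨τ, -, hSτ⟩, hDS⟩
    have hm := h.left_pos
    have hn := h.right_pos
    have e1 : ∫ x, twoStep E F 1 0 x ∂μ = μ.real E := by
      rw [h.integral_comp (fun x => x) rfl]; ring
    have hval : ∀ c e, 0 < c → 0 ≤ e → fdpd μ φ 0 (twoStep E F 1 0) (twoStep E F c e) =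
        ((deriv (fun z => (φ z).toReal) (μ.real E) * -(μ.real E * Real.log c) -
          (φ (μ.real E)).toReal + (φ (μ.real E * c + μ.real F * e)).toReal : ℝ) : EReal) := by
      intro c e hc he
      have hC : 0 < μ.real E * c + μ.real F * e := by positivity
      have e2 : ∫ x, twoStep E F c e x ∂μ = μ.real E * c + μ.real F * e :=
        h.integral_comp (fun x => x) rfl c e
      rw [fdpd_zero_eq_coe (A := (φ (μ.real E)).toReal)
      (C := (φ (μ.real E * c + μ.real F * e)).toReal) (by rw [e1, hφ.coe_toReal hm]) (by rw [e2, hφ.coe_toReal hC]),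
        h.integral_comp₂ (fun x y => x * Real.log (x / y)) (zero_mul _), e1]
      simp
    have hscore : ∀ c e, holderScore μ η 0 (twoStep E F 1 0) (twoStep E F c e) =
        -(μ.real E * Real.log c) + (μ.real E * c + μ.real F * e) := by
      intro c e
      rw [holderScore, if_pos rfl, h.integral_comp₂ (fun x y => x * Real.log y) (zero_mul _),
        h.integral_comp (fun x => x) rfl]
      ring
    set Φ : ℝ → ℝ := fun z => (φ z).toReal with hΦ
    obtain ⟨b, hb⟩ := h.affine_of_parameter_zero (Φ := Φ) (d := deriv Φ (μ.real E)) (by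
      intro c e c' e' hc he hc' he' heq
      have hA := h.mem_Dom le_rfl one_pos hc he
      have hA' := h.mem_Dom le_rfl one_pos hc' he'
      have hD : D (twoStep E F 1 0) (twoStep E F c e) =
          D (twoStep E F 1 0) (twoStep E F c' e') := by
        rw [hDS _ _ hA, hDS _ _ hA', hSτ _ _ hA, hSτ _ _ hA', hscore, hscore, heq]
      rw [hDφ _ _ hA, hDφ _ _ hA', hval c e hc he, hval c' e' hc' he',
        EReal.coe_eq_coe_iff] at hD
      simp only [hΦ]
      linarith)
    set a := deriv Φ (μ.real E)
    have ha : 0 < a := by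
      have := hφ.strictMonoOn_toReal (show (0 : ℝ) < 1 by norm_num)
        (show (0 : ℝ) < 2 by norm_num) (by norm_num)
      change Φ 1 < Φ 2 at this
      rw [hb 1 one_pos, hb 2 two_pos] at this
      linarith
    have hderiv : ∀ x, 0 < x → deriv Φ x = a := by
      intro x hx
      have heq : Φ =ᶠ[nhds x] fun y => a * y + b :=
        Filter.eventually_of_mem (Ioi_mem_nhds hx) hb
      rw [heq.deriv_eq]
      simp
    refine ⟨a, ha, fun g f hgf => ?_⟩
    have hG := hgf.1.integral_pos_zero
    have hF := hgf.2.1.integral_pos_zero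
    rw [hDφ g f hgf, fdpd_zero_eq_coe (hφ.coe_toReal hG).symm (hφ.coe_toReal hF).symm,
      jhhb_one_zero, ← EReal.coe_mul, EReal.coe_eq_coe_iff, hderiv _ hG]
    change _ - Φ _ + Φ _ = _
    rw [hb _ hG, hb _ hF]
    ring
  · rintro D ⟨a, ha, hD⟩
    -- Both the generator and the rescaling are multiplication by `a`; the score for parameter zero
    -- ignores `η`.
    refine ⟨⟨fun x => ((a * x : ℝ) : EReal), ⟨?_, ?_, ?_, ?_⟩, ?_⟩, fun _ => 0,
      fun h0 => absurd h0 (lt_irrefl _), fun g f => ((a * holderScore μ (fun _ => 0) 0 g f : ℝ) : EReal),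
      ⟨fun s => ((a * s : ℝ) : EReal), ?_, fun _ _ _ => rfl⟩, ?_⟩
    · exact (continuous_coe_real_ereal.comp (continuous_const_mul a)).continuousOn
    · intro x _ y _ hxy
      exact EReal.coe_lt_coe_iff.2 (mul_lt_mul_of_pos_left hxy ha)
    · simp only [EReal.toReal_coe]
      exact convexOn_exp.smul ha.le
    · intro _
      simp only [EReal.toReal_coe]
      fun_prop
    · intro g f hgf
      rw [hD g f hgf, jhhb_one_zero, fdpd_zero_eq_coe (φ := fun x => ((a * x : ℝ) : EReal)) rfl rfl, ← EReal.coe_mul,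
        EReal.coe_eq_coe_iff]
      simp only [EReal.toReal_coe]
      rw [deriv_const_mul_field, deriv_id'']
      ring
    · intro x _ y _ hxy
      exact EReal.coe_lt_coe_iff.2 (mul_lt_mul_of_pos_left hxy ha)
    · intro g f hgf
      rw [hD g f hgf, jhhb_one_zero, integral_mul_log_div hgf, ← EReal.coe_mul, ← EReal.coe_sub,
        EReal.coe_eq_coe_iff, holderScore, holderScore, if_pos rfl, if_pos rfl]
      ring
end

/-! ### JHHB divergences with positive parameter as members of both families. -/

theorem StrictMonoOn.toReal_of_finite {τ : ℝ → EReal} {V : Set ℝ} (hτ : StrictMonoOn τ V)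
    (hfin : ∀ s ∈ V, ((τ s).toReal : EReal) = τ s) : StrictMonoOn (fun s => (τ s).toReal) V := by
  intro x hx y hy hxy
  rw [← EReal.coe_lt_coe_iff, hfin x hx, hfin y hy]
  exact hτ hx hy hxy

/-- The sign-preserving power function. -/
noncomputable def signedPow (p s : ℝ) : ℝ := if 0 ≤ s then s ^ p else -(-s) ^ p

theorem strictMono_signedPow {p : ℝ} (hp : 0 < p) : StrictMono (signedPow p) := by
  intro x y hxy
  unfold signedPow
  split_ifs with hx hy hy
  · exact Real.rpow_lt_rpow hx hxy hp
  · linarith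
  · have := Real.rpow_pos_of_pos (show 0 < -x by linarith) p
    have := Real.rpow_nonneg hy p
    linarith
  · exact neg_lt_neg (Real.rpow_lt_rpow (by linarith) (by linarith) hp)

theorem signedPow_mul {p s c : ℝ} (hc : 0 < c) : signedPow p (s * c) = signedPow p s * c ^ p := by
  unfold signedPow
  by_cases hs : 0 ≤ s
  · rw [if_pos hs, if_pos (mul_nonneg hs hc.le), Real.mul_rpow hs hc.le]
  · rw [if_neg hs, if_neg (not_le.2 (mul_neg_of_neg_of_pos (not_le.1 hs) hc)), ← neg_mul,
      Real.mul_rpow (by linarith) hc.le]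
    ring

theorem signedPow_signedPow_inv {p : ℝ} (hp : p ≠ 0) (s : ℝ) :
    signedPow p (signedPow p⁻¹ s) = s := by
  unfold signedPow
  by_cases hs : 0 ≤ s
  · rw [if_pos hs, if_pos (Real.rpow_nonneg hs _), Real.rpow_inv_rpow hs hp]
  · have h0 : 0 < (-s) ^ p⁻¹ := Real.rpow_pos_of_pos (by linarith) _
    rw [if_neg hs, if_neg (by linarith), neg_neg, Real.rpow_inv_rpow (by linarith) hp, neg_neg]

/-- After raising to the power `ζ`, the lower bound is Bernoulli's inequality for `z ^ ζ` with
exponent `1 + γ`. The signed power is needed because `γ - (1 + γ) * z ^ ζ` changes sign. -/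
theorem isHolderGenerator_signedPow {γ ζ : ℝ} (hζ : 0 < ζ) :
    IsHolderGenerator γ fun z => signedPow ζ⁻¹ (γ - (1 + γ) * z ^ ζ) := by
  intro hγ
  refine ⟨?_, fun z hz => ?_⟩
  · change signedPow ζ⁻¹ (γ - (1 + γ) * 1 ^ ζ) = -1
    rw [Real.one_rpow, signedPow, if_neg (by linarith)]
    norm_num
  · have hnn : 0 ≤ z ^ (1 + γ) := Real.rpow_nonneg hz _
    change _ ≤ signedPow ζ⁻¹ (γ - (1 + γ) * z ^ ζ)
    unfold signedPow
    split_ifs with h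
    · have := Real.rpow_nonneg h ζ⁻¹
      linarith
    · rw [neg_le_neg_iff, ← Real.rpow_le_rpow_iff (Real.rpow_nonneg (by linarith) _) hnn hζ,
        Real.rpow_inv_rpow (by linarith) hζ.ne', ← Real.rpow_mul hz, mul_comm (1 + γ) ζ, Real.rpow_mul hz]
      have hy : 0 ≤ z ^ ζ := Real.rpow_nonneg hz _
      have := one_add_mul_self_le_rpow_one_add (s := z ^ ζ - 1) (by linarith)
        (p := 1 + γ) (by linarith)
      rw [add_sub_cancel] at this
      linarith

theorem isHolderGenerator_neg_rpow (γ : ℝ) : IsHolderGenerator γ fun z => -z ^ (1 + γ) :=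
  fun _ => ⟨by simp, fun _ _ => le_rfl⟩

theorem isFDPDGenerator_rpow {γ a ζ : ℝ} (hγ : γ ≠ 0) (ha : 0 < a) (hζ : 0 < ζ) :
    IsFDPDGenerator γ fun x => ((a * x ^ ζ : ℝ) : EReal) where
  continuousOn := (continuous_coe_real_ereal.comp
    (continuous_const.mul (Real.continuous_rpow_const hζ.le))).continuousOn
  strictMonoOn x hx y _ hxy := EReal.coe_lt_coe_iff.2
    (mul_lt_mul_of_pos_left (Real.rpow_lt_rpow hx hxy hζ) ha)
  convexOn := by
    simp only [EReal.toReal_coe, ← Real.exp_mul]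
    exact ((convexOn_exp.comp_linearMap (LinearMap.mulRight ℝ ζ)).smul ha.le)
  differentiableOn h := absurd h hγ

theorem isFDPDGenerator_log {γ a : ℝ} (hγ : γ ≠ 0) (ha : 0 < a) :
    IsFDPDGenerator γ fun x => (a : EReal) * ENNReal.log (ENNReal.ofReal x) := by
  simp only [← ENNReal.log_rpow]
  refine ⟨?_, ?_, ?_, fun h => absurd h hγ⟩
  · exact (ENNReal.continuous_log.comp
      ((ENNReal.continuous_rpow_const).comp ENNReal.continuous_ofReal)).continuousOn
  · intro x hx y _ hxy
    exact ENNReal.log_strictMono (ENNReal.strictMono_rpow_of_pos ha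
      ((ENNReal.ofReal_lt_ofReal_iff (lt_of_le_of_lt hx hxy)).2 hxy))
  · have : (fun s : ℝ => (ENNReal.log (ENNReal.ofReal (Real.exp s) ^ a)).toReal) =
        fun s => a * s := by
      funext s
      rw [ENNReal.log_rpow, ENNReal.log_ofReal_of_pos (Real.exp_pos s), Real.log_exp,
        ← EReal.coe_mul, EReal.toReal_coe]
    rw [this]
    exact (convexOn_id convex_univ).smul ha.le

section
variable {Ω : Type*} [MeasurableSpace Ω] {μ : Measure Ω} {E F : Set Ω}

theorem jhhb_of_pos {γ ζ : ℝ} (hγ : 0 < γ) (hζ : 0 < ζ) (g f : Ω → ℝ) :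
    jhhb μ ζ γ g f = ((1 / (γ * ζ) * (∫ x, g x ^ (1 + γ) ∂μ) ^ ζ
        - (1 + γ) / (γ * ζ) * (∫ x, g x * f x ^ γ ∂μ) ^ ζ
        + 1 / ζ * (∫ x, f x ^ (1 + γ) ∂μ) ^ ζ : ℝ) : EReal) := by
  rw [jhhb, if_neg hγ.ne', if_neg hζ.ne']

/-- Values of the logarithmic member of the family. -/
theorem jhhb_zero_of_pos {γ : ℝ} (hγ : 0 < γ) {g f : Ω → ℝ} (h : (g, f) ∈ Dom μ γ)
    (hB : 0 < ∫ x, g x * f x ^ γ ∂μ) :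
    jhhb μ 0 γ g f = ((1 / γ * Real.log (∫ x, g x ^ (1 + γ) ∂μ)
        - (1 + γ) / γ * Real.log (∫ x, g x * f x ^ γ ∂μ)
        + Real.log (∫ x, f x ^ (1 + γ) ∂μ) : ℝ) : EReal) := by
  rw [jhhb, if_neg hγ.ne', if_pos rfl, ENNReal.log_ofReal_of_pos hB,
    ENNReal.log_ofReal_of_pos (h.1.integral_pos hγ.le),
    ENNReal.log_ofReal_of_pos (h.2.1.integral_pos hγ.le)]
  norm_cast

theorem fdpd_eq_top {φ : ℝ → EReal} {γ : ℝ} (hγ : 0 < γ) {g f : Ω → ℝ} {A C : ℝ}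
    (hA : φ (∫ x, g x ^ (1 + γ) ∂μ) = A) (hB : φ (∫ x, g x * f x ^ γ ∂μ) = ⊥)
    (hC : φ (∫ x, f x ^ (1 + γ) ∂μ) = C) : fdpd μ φ γ g f = ⊤ := by
  rw [fdpd, if_neg hγ.ne', hA, hB, hC, EReal.coe_mul_bot_of_pos (by positivity), ← EReal.coe_mul,
    EReal.coe_sub_bot, EReal.top_add_coe]

theorem jhhb_zero_eq_top {γ : ℝ} (hγ : 0 < γ) {g f : Ω → ℝ} (h : (g, f) ∈ Dom μ γ)
    (hB : ∫ x, g x * f x ^ γ ∂μ = 0) : jhhb μ 0 γ g f = ⊤ := by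
  have := fdpd_eq_top (μ := μ) (φ := fun x => ENNReal.log (ENNReal.ofReal x)) hγ
    (ENNReal.log_ofReal_of_pos (h.1.integral_pos hγ.le)) (by simp [hB])
    (ENNReal.log_ofReal_of_pos (h.2.1.integral_pos hγ.le))
  rw [fdpd, if_neg hγ.ne'] at this
  rw [jhhb, if_neg hγ.ne', if_pos rfl]
  exact this

theorem fdpd_eq_mul_jhhb {φ : ℝ → EReal} {γ κ ζ α : ℝ} (hγ : 0 < γ) (hζ : 0 < ζ)
    (hφ : ∀ x, 0 ≤ x → φ x = ((α + κ * x ^ ζ : ℝ) : EReal)) {g f : Ω → ℝ}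
    (h : (g, f) ∈ Dom μ γ) : fdpd μ φ γ g f = ((κ * ζ : ℝ) : EReal) * jhhb μ ζ γ g f := by
  rw [fdpd_eq_coe hγ.ne' (hφ _ (h.1.integral_pos hγ.le).le)
    (hφ _ (h.1.integral_mul_rpow_nonneg h.2.1)) (hφ _ (h.2.1.integral_pos hγ.le).le),
    jhhb_of_pos hγ hζ, ← EReal.coe_mul, EReal.coe_eq_coe_iff]
  field_simp
  ring

theorem fdpd_eq_mul_jhhb_zero {φ : ℝ → EReal} {γ β α : ℝ} (hγ : 0 < γ) (hβ : 0 < β)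
    (hφ : ∀ x, 0 < x → φ x = ((α + β * Real.log x : ℝ) : EReal)) (hφ0 : φ 0 = ⊥) {g f : Ω → ℝ}
    (h : (g, f) ∈ Dom μ γ) : fdpd μ φ γ g f = (β : EReal) * jhhb μ 0 γ g f := by
  have hA := hφ _ (h.1.integral_pos hγ.le)
  have hC := hφ _ (h.2.1.integral_pos hγ.le)
  rcases (h.1.integral_mul_rpow_nonneg h.2.1).eq_or_lt with hB | hB
  · rw [fdpd_eq_top hγ hA (by rw [← hB, hφ0]) hC, jhhb_zero_eq_top hγ h hB.symm,
      EReal.coe_mul_top_of_pos hβ]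
  · rw [fdpd_eq_coe hγ.ne' hA (hφ _ hB) hC, jhhb_zero_of_pos hγ h hB, ← EReal.coe_mul,
      EReal.coe_eq_coe_iff]
    field_simp
    ring

theorem jhhbFamily_subset_fdpdFamily {γ ζ : ℝ} (hγ : 0 < γ) (hζ : 0 ≤ ζ) :
    jhhbFamily μ ζ γ (Dom μ γ) ⊆ fdpdFamily μ γ (Dom μ γ) := by
  rintro D ⟨a, ha, hD⟩
  rcases hζ.eq_or_lt with rfl | hζ
  · refine ⟨_, isFDPDGenerator_log hγ.ne' ha, fun g f hgf => ?_⟩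
    rw [hD g f hgf, fdpd_eq_mul_jhhb_zero (α := 0) hγ ha _ _ hgf]
    · intro x hx
      rw [ENNReal.log_ofReal_of_pos hx, zero_add, EReal.coe_mul]
    · simp [EReal.coe_mul_bot_of_pos ha]
  · refine ⟨_, isFDPDGenerator_rpow hγ.ne' (div_pos ha hζ) hζ, fun g f hgf => ?_⟩
    rw [hD g f hgf, fdpd_eq_mul_jhhb (α := 0) (κ := a / ζ) hγ hζ (fun x _ => by rw [zero_add]) hgf,
      div_mul_cancel₀ _ hζ.ne']

theorem jhhbFamily_subset_holderFamily_of_pos {γ ζ : ℝ} (hγ : 0 < γ) (hζ : 0 < ζ) :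
    jhhbFamily μ ζ γ (Dom μ γ) ⊆ holderFamily μ γ (Dom μ γ) := by
  rintro D ⟨a, ha, hD⟩
  set η : ℝ → ℝ := fun z => signedPow ζ⁻¹ (γ - (1 + γ) * z ^ ζ) with hη
  have hηg : IsHolderGenerator γ η := isHolderGenerator_signedPow hζ
  -- The signed power `ζ` undoes the one in `η` and is homogeneous, so the score turns into `γ C^ζ -
  -- (1 + γ) B^ζ`.
  set τ : ℝ → EReal := fun s => ((a / (γ * ζ) * signedPow ζ s : ℝ) : EReal) with hτ
  have hc : 0 < a / (γ * ζ) := by positivity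
  refine ⟨η, hηg, fun g f => τ (holderScore μ η γ g f), ⟨τ, ?_, fun _ _ _ => rfl⟩, ?_⟩
  · intro x _ y _ hxy
    exact EReal.coe_lt_coe_iff.2 (mul_lt_mul_of_pos_left (strictMono_signedPow hζ hxy) hc)
  · intro g f hgf
    have hA := hgf.1.integral_pos hγ.le
    have hC := hgf.2.1.integral_pos hγ.le
    have hB := hgf.1.integral_mul_rpow_nonneg hgf.2.1
    have h1 : signedPow ζ (holderScore μ η γ g f) =
        γ * (∫ x, f x ^ (1 + γ) ∂μ) ^ ζ - (1 + γ) * (∫ x, g x * f x ^ γ ∂μ) ^ ζ := by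
      rw [holderScore, if_neg hγ.ne', signedPow_mul hC, hη, signedPow_signedPow_inv hζ.ne',
        Real.div_rpow hB hC.le]
      have : 0 < (∫ x, f x ^ (1 + γ) ∂μ) ^ ζ := Real.rpow_pos_of_pos hC _
      field_simp
    have h2 : signedPow ζ (holderScore μ η γ g g) = -(∫ x, g x ^ (1 + γ) ∂μ) ^ ζ := by
      rw [holderScore_self hγ (hηg hγ).1 hgf.1, signedPow, if_neg (by linarith), neg_neg]
    rw [hD g f hgf, jhhb_of_pos hγ hζ]
    simp only [hτ, h1, h2]
    rw [← EReal.coe_mul, ← EReal.coe_sub, EReal.coe_eq_coe_iff]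
    field_simp
    ring

theorem jhhbFamily_subset_holderFamily_zero {γ : ℝ} (hγ : 0 < γ) :
    jhhbFamily μ 0 γ (Dom μ γ) ⊆ holderFamily μ γ (Dom μ γ) := by
  rintro D ⟨a, ha, hD⟩
  set η : ℝ → ℝ := fun z => -z ^ (1 + γ) with hη
  have hηg : IsHolderGenerator γ η := isHolderGenerator_neg_rpow γ
  -- The scores here are at most `0`, with `0` attained exactly when `⟨g f^γ⟩ = 0`, where the
  -- divergence is `⊤`.
  set τ : ℝ → EReal := fun s => if s < 0 then ((-(a / γ * Real.log (-s)) : ℝ) : EReal) else ⊤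
    with hτ
  have hc : 0 < a / γ := by positivity
  have hscore : ∀ g f, (g, f) ∈ Dom μ γ → holderScore μ η γ g f =
      -(((∫ x, g x * f x ^ γ ∂μ) / ∫ x, f x ^ (1 + γ) ∂μ) ^ (1 + γ) * ∫ x, f x ^ (1 + γ) ∂μ) := by
    intro g f _
    rw [holderScore, if_neg hγ.ne', hη, neg_mul]
  refine ⟨η, hηg, fun g f => τ (holderScore μ η γ g f), ⟨τ, ?_, fun _ _ _ => rfl⟩, ?_⟩
  · rintro x - _ ⟨⟨g, f⟩, hgf, rfl⟩ hxy
    have hC := hgf.2.1.integral_pos hγ.le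
    have hB := hgf.1.integral_mul_rpow_nonneg hgf.2.1
    have hle : holderScore μ η γ g f ≤ 0 := by
      rw [hscore g f hgf]
      have := mul_nonneg (Real.rpow_nonneg (div_nonneg hB hC.le) (1 + γ)) hC.le
      linarith
    have hx : x < 0 := lt_of_lt_of_le hxy hle
    simp only [hτ, if_pos hx]
    rcases hle.lt_or_eq with h | h
    · rw [if_pos h, EReal.coe_lt_coe_iff, neg_lt_neg_iff]
      exact mul_lt_mul_of_pos_left (Real.log_lt_log (by linarith) (neg_lt_neg hxy)) hc
    · rw [if_neg (by linarith)]
      exact EReal.coe_lt_top _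
  · intro g f hgf
    have hA := hgf.1.integral_pos hγ.le
    have hC := hgf.2.1.integral_pos hγ.le
    have hself : τ (holderScore μ η γ g g) =
        ((-(a / γ * Real.log (∫ x, g x ^ (1 + γ) ∂μ)) : ℝ) : EReal) := by
      simp only [hτ]
      rw [holderScore_self hγ (hηg hγ).1 hgf.1, if_pos (by linarith), neg_neg]
    rw [hD g f hgf]
    change _ = τ _ - τ _
    rw [hself]
    rcases (hgf.1.integral_mul_rpow_nonneg hgf.2.1).eq_or_lt with hB | hB
    · have h0 : holderScore μ η γ g f = 0 := by
        rw [hscore g f hgf, ← hB, zero_div, Real.zero_rpow (by linarith)]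
        ring
      rw [jhhb_zero_eq_top hγ hgf hB.symm, h0, EReal.coe_mul_top_of_pos ha]
      simp only [hτ, lt_irrefl, if_false]
      rw [EReal.top_sub_coe]
    · have hp : 0 < ((∫ x, g x * f x ^ γ ∂μ) / ∫ x, f x ^ (1 + γ) ∂μ) ^ (1 + γ) := by positivity
      rw [jhhb_zero_of_pos hγ hgf hB, hscore g f hgf]
      simp only [hτ]
      rw [if_pos (neg_lt_zero.2 (mul_pos hp hC)), neg_neg, Real.log_mul hp.ne' hC.ne',
        Real.log_rpow (div_pos hB hC), Real.log_div hB.ne' hC.ne', ← EReal.coe_mul,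
        ← EReal.coe_sub, EReal.coe_eq_coe_iff]
      field_simp
      ring

/-! ### The intersection for equal positive parameters, and the conclusion. -/

theorem fdpd_inter_holder_subset (h : TestPair μ E F) {γ : ℝ} (hγ : 0 < γ) :
    fdpdFamily μ γ (Dom μ γ) ∩ holderFamily μ γ (Dom μ γ) ⊆
      ⋃ ζ ∈ Ici (0 : ℝ), jhhbFamily μ ζ γ (Dom μ γ) := by
  rintro D ⟨⟨φ, hφ, hDφ⟩, η, hη, S, ⟨τ, hτ, hSτ⟩, hDS⟩
  obtain ⟨hη1, hη2⟩ := hη hγ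
  have hcore : ∀ A B C, 0 < A → 0 < B → 0 < C → B ^ (1 + γ) ≤ A * C ^ γ →
      (-A ∈ (fun p : (Ω → ℝ) × (Ω → ℝ) => holderScore μ η γ p.1 p.2) '' Dom μ γ ∧
        η (B / C) * C ∈ (fun p : (Ω → ℝ) × (Ω → ℝ) => holderScore μ η γ p.1 p.2) '' Dom μ γ) ∧
      ((1 / γ * (φ A).toReal - (1 + γ) / γ * (φ B).toReal + (φ C).toReal : ℝ) : EReal) =
        τ (η (B / C) * C) - τ (-A) := by
    intro A B C hA hB hC hABC
    obtain ⟨g, f, hgf, rfl, rfl, rfl⟩ := h.exists_integrals hγ hA hB hC hABC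
    have hgg : (g, g) ∈ Dom μ γ := ⟨hgf.1, hgf.1, fun h0 => absurd h0 hγ.ne'⟩
    have hs : holderScore μ η γ g f = η ((∫ x, g x * f x ^ γ ∂μ) / ∫ x, f x ^ (1 + γ) ∂μ) *
        ∫ x, f x ^ (1 + γ) ∂μ := by
      rw [holderScore, if_neg hγ.ne']
    have hs' := holderScore_self hγ hη1 hgf.1
    refine ⟨⟨⟨(g, g), hgg, hs'⟩, ⟨(g, f), hgf, hs⟩⟩, ?_⟩
    rw [← hs, ← hs', ← hSτ g f hgf, ← hSτ g g hgg, ← hDS g f hgf, hDφ g f hgf]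
    exact (fdpd_eq_coe hγ.ne' (hφ.coe_toReal hA).symm (hφ.coe_toReal hB).symm
      (hφ.coe_toReal hC).symm).symm
  -- Every positive pair `B, C` extends to an admissible triple, by equality in Hölder's inequality.
  have hadm : ∀ B C : ℝ, 0 < B → 0 < C → 0 < B ^ (1 + γ) / C ^ γ ∧
      B ^ (1 + γ) ≤ B ^ (1 + γ) / C ^ γ * C ^ γ := by
    intro B C hB hC
    have : 0 < C ^ γ := Real.rpow_pos_of_pos hC _
    exact ⟨by positivity, (div_mul_cancel₀ _ this.ne').ge⟩
  have hself : ∀ A : ℝ, 0 < A → A ^ (1 + γ) ≤ A * A ^ γ := fun A hA => by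
    rw [Real.rpow_add hA, Real.rpow_one]
  -- Only scores coming from positive triples are kept: there the divergence is finite, which forces
  -- `τ` to be finite, whereas `τ` may be infinite at scores of pairs with `⟨g f^γ⟩ = 0`.
  set V : Set ℝ := {s | (∃ A, 0 < A ∧ s = -A) ∨ ∃ B C, 0 < B ∧ 0 < C ∧ s = η (B / C) * C} with hV
  have hVsub : V ⊆ (fun p : (Ω → ℝ) × (Ω → ℝ) => holderScore μ η γ p.1 p.2) '' Dom μ γ := by
    rintro s (⟨A, hA, rfl⟩ | ⟨B, C, hB, hC, rfl⟩)
    · exact (hcore A A A hA hA hA (hself A hA)).1.1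
    · exact (hcore _ B C (hadm B C hB hC).1 hB hC (hadm B C hB hC).2).1.2
  have hVfin : ∀ s ∈ V, ((τ s).toReal : EReal) = τ s := by
    rintro s (⟨A, hA, rfl⟩ | ⟨B, C, hB, hC, rfl⟩)
    · obtain ⟨_, b, _, hb, _⟩ :=
        EReal.exists_coe_of_sub_eq_coe (hcore A A A hA hA hA (hself A hA)).2.symm
      rw [hb, EReal.toReal_coe]
    · obtain ⟨b, _, hb, _, _⟩ := EReal.exists_coe_of_sub_eq_coe
        (hcore _ B C (hadm B C hB hC).1 hB hC (hadm B C hB hC).2).2.symm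
      rw [hb, EReal.toReal_coe]
  have hV1 : ∀ A, 0 < A → -A ∈ V := fun A hA => Or.inl ⟨A, hA, rfl⟩
  have hV2 : ∀ B C, 0 < B → 0 < C → η (B / C) * C ∈ V := fun B C hB hC =>
    Or.inr ⟨B, C, hB, hC, rfl⟩
  simp only [mem_iUnion, mem_Ici, exists_prop]
  rcases generator_eq_log_or_rpow (t := fun s => (τ s).toReal) hγ hφ.strictMonoOn_toReal hφ.convexOn
    ((hτ.mono hVsub).toReal_of_finite hVfin) hη2 hV1 hV2 (by
      intro A B C hA hB hC hABC
      have := (hcore A B C hA hB hC hABC).2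
      rw [← hVfin _ (hV1 A hA), ← hVfin _ (hV2 B C hB hC), ← EReal.coe_sub,
        EReal.coe_eq_coe_iff] at this
      exact this) with ⟨α, β, hβ, hx⟩ | ⟨α, κ, ζ, hζ, hκ, hx⟩
  · refine ⟨0, le_rfl, β, hβ, fun g f hgf => ?_⟩
    rw [hDφ g f hgf]
    refine fdpd_eq_mul_jhhb_zero (α := α) hγ hβ
      (fun x h0 => by rw [← hx x h0, hφ.coe_toReal h0]) ?_ hgf
    -- For each real `y`, strict monotonicity puts `φ 0` below the value `y`, attained at `exp ((y -
    -- α) / β)`.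
    rw [EReal.eq_bot_iff_forall_lt]
    intro y
    have h0 := Real.exp_pos ((y - α) / β)
    have := hφ.strictMonoOn self_mem_Ici h0.le h0
    rw [← hφ.coe_toReal h0] at this
    have hy : (φ (Real.exp ((y - α) / β))).toReal = y := by
      have := hx _ h0
      rw [this, Real.log_exp]
      field_simp
      ring
    rwa [hy] at this
  · refine ⟨ζ, hζ.le, κ * ζ, mul_pos hκ hζ, fun g f hgf => ?_⟩
    rw [hDφ g f hgf]
    refine fdpd_eq_mul_jhhb (α := α) hγ hζ (fun x h0 => ?_) hgf
    rcases h0.eq_or_lt with rfl | h0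
    · have h1 : Filter.Tendsto φ (nhdsWithin 0 (Ioi 0)) (nhds (φ 0)) :=
        (hφ.continuousOn 0 self_mem_Ici).mono_left (nhdsWithin_mono _ Ioi_subset_Ici_self)
      have hcont : Continuous fun x : ℝ => ((α + κ * x ^ ζ : ℝ) : EReal) :=
        continuous_coe_real_ereal.comp
          (continuous_const.add (continuous_const.mul (Real.continuous_rpow_const hζ.le)))
      have h2 := (hcont.tendsto 0).mono_left (nhdsWithin_le_nhds (s := Ioi 0))
      refine tendsto_nhds_unique h1 (h2.congr' ?_)
      filter_upwards [self_mem_nhdsWithin] with x hx0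
      rw [← hx x hx0, hφ.coe_toReal hx0]
    · rw [← hx x h0, hφ.coe_toReal h0]

theorem fdpd_inter_holder_eq (h : TestPair μ E F) {γ : ℝ} (hγ : 0 < γ) :
    fdpdFamily μ γ (Dom μ γ) ∩ holderFamily μ γ (Dom μ γ) =
      ⋃ ζ ∈ Ici (0 : ℝ), jhhbFamily μ ζ γ (Dom μ γ) := by
  refine (fdpd_inter_holder_subset h hγ).antisymm (iUnion₂_subset fun ζ hζ => subset_inter
    (jhhbFamily_subset_fdpdFamily hγ hζ) ?_)
  rcases (mem_Ici.1 hζ).eq_or_lt with rfl | hζ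
  · exact jhhbFamily_subset_holderFamily_zero hγ
  · exact jhhbFamily_subset_holderFamily_of_pos hγ hζ
end

theorem corollary1 {d : ℕ} (hd : 1 ≤ d) (X : Set (EuclideanSpace ℝ (Fin d)))
    (hX : MeasurableSet X) (hpos : 0 < volume X) :
    (∀ γ : ℝ, 0 < γ →
      fdpdFamily (volume.restrict X) γ (Dom (volume.restrict X) γ) ∩
          holderFamily (volume.restrict X) γ (Dom (volume.restrict X) γ) =
        ⋃ ζ ∈ Set.Ici (0 : ℝ),
          jhhbFamily (volume.restrict X) ζ γ (Dom (volume.restrict X) γ)) ∧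
    (fdpdFamily (volume.restrict X) 0 (Dom (volume.restrict X) 0) ∩
          holderFamily (volume.restrict X) 0 (Dom (volume.restrict X) 0) =
        jhhbFamily (volume.restrict X) 1 0 (Dom (volume.restrict X) 0)) ∧
    (∀ γ₁ γ₂ : ℝ, 0 ≤ γ₁ → 0 ≤ γ₂ → γ₁ ≠ γ₂ →
      fdpdFamily (volume.restrict X) γ₁
            (Dom (volume.restrict X) γ₁ ∩ Dom (volume.restrict X) γ₂) ∩
          holderFamily (volume.restrict X) γ₂
            (Dom (volume.restrict X) γ₁ ∩ Dom (volume.restrict X) γ₂) =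
        ∅) := by
  have : Nonempty (Fin d) := ⟨⟨0, hd⟩⟩
  obtain ⟨E, F, G, hE, hF, hG, hEF, hEG, hFG, hEt, hFt, hGt, hE0, hF0, hG0⟩ :=
    exists_three_disjoint (μ := volume.restrict X) (by rw [Measure.restrict_apply_univ]; exact hpos.ne')
  have h : TestPair (volume.restrict X) E F := ⟨hE, hF, hEF, hEt, hFt, hE0, hF0⟩
  have hr : (volume.restrict X).real (F ∪ G) =
      (volume.restrict X).real F + (volume.restrict X).real G := measureReal_union hFG hG hFt hGt
  -- The third set makes `F` and `F ∪ G` differ in measure while `E` is shared, as the case of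
  -- different parameters requires.
  have h' : TestPair (volume.restrict X) E (F ∪ G) :=
    ⟨hE, hF.union hG, hEF.union_right hEG, hEt, measure_union_ne_top hFt hGt, hE0,
      by rw [hr]; exact add_pos hF0 hG0⟩
  exact ⟨fun γ hγ => fdpd_inter_holder_eq h hγ, fdpd_inter_holder_zero h,
    fun γ₁ γ₂ h₁ h₂ hne => fdpd_inter_holder_eq_empty h h' (by rw [hr]; linarith) h₁ h₂ hne⟩
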